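/- **Conventions.** Every space is an infinite topological space (not assumed Hausdorff, or Lindelöf, unless stated). A *cover* of a space $X$ is a family $\mathcal U$ with $\bigcup\mathcal U=X$ and $X\notin\mathcal U$. Let $\mathrm O(X)$ be the set of all countable open covers of $X$; let $\Omega(X)$ be the set of all $\mathcal U\in \mathrm O(X)$ such that each finite subset of $X$ is contained in a member of $\mathcal U$; and let $\gimel(\Gamma)(X)$ be the set of all $\mathcal U\in \mathrm O(X)$ that have a bijective enumeration $\mathcal U=\{U_n:n\in\mathbb N\}$ and a strictly increasing $h:\mathbb N\to\mathbb N$ such that, for each $x\in X$, we have $x\in\bigcup_{k=h(n)}^{h(n+1)-1}U_k$ for all but finitely many $n$. The space $X$ satisfies $S_1(\mathcal A,\mathcal B)$ if for each sequence $\mathcal U_n\in\mathcal A(X)$, $n\in\mathbb N$, there are $U_n\in\mathcal U_n$ with $\{U_n:n\in\mathbb N\}\in\mathcal B(X)$. It is *Rothberger* if it satisfies $S_1(\mathrm O,\mathrm O)$, and *Gerlits–Nagy* if it satisfies $S_1(\Omega,\gimel(\Gamma))$. Let $\mathcal P$ be the class of all spaces $X$ such that $X\times Y$ is Rothberger for every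 Lindelöf Gerlits–Nagy space $Y$. For a cardinal $\kappa$, a space $X$ is *$\kappa$-concentrated* if there is a countable $D\subseteq X$ such that $|X\setminus U|<\kappa$ for each open $U\supseteq D$. Let $\mathrm{cov}(\mathcal M)$ be the least number of meager subsets of $\mathbb R$ whose union is $\mathbb R$, and let $\mathrm{cf}$ denote cofinality. **Theorem.** 1. Let $\lambda$ be a regular uncountable cardinal with $\lambda\le\mathrm{cov}(\mathcal M)$. The least cardinal $\kappa$ such that some regular space not in $\mathcal P$ is a union of $\kappa$ many $\lambda$-concentrated subspaces is $\mathrm{cov}(\mathcal M)$. 2. The least cardinal $\kappa$ such that some regular space not in $\mathcal P$ is a union of $\kappa$ many $\mathrm{cov}(\mathcal M)$-concentrated subspaces is $\mathrm{cf}(\mathrm{cov}(\mathcal M))$. -/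

import Mathlib

open Set
open scoped Cardinal

universe u v

/-- The countable open covers of a space `X`; the space itself is not allowed as a member of a
cover. -/
def openCovers (X : Type u) [TopologicalSpace X] : Set (Set (Set X)) :=
  {𝒰 | 𝒰.Countable ∧ (∀ U ∈ 𝒰, IsOpen U) ∧ ⋃₀ 𝒰 = univ ∧ univ ∉ 𝒰}

/-- The family `Ω(X)`: countable open covers such that every finite subset of `X` is contained in
some member. -/
def omegaCovers (X : Type u) [TopologicalSpace X] : Set (Set (Set X)) :=
  {𝒰 | 𝒰 ∈ openCovers X ∧ ∀ F : Set X, F.Finite → ∃ U ∈ 𝒰, F ⊆ U}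

/-- The family `ℷ(Γ)(X)`: covers with a bijective enumeration `U 0, U 1, …` that can be cut into
consecutive finite blocks, so that each point belongs to the union of all but finitely many
blocks. -/
def gimelGammaCovers (X : Type u) [TopologicalSpace X] : Set (Set (Set X)) :=
  {𝒰 | 𝒰 ∈ openCovers X ∧
    ∃ U : ℕ → Set X, Function.Injective U ∧ range U = 𝒰 ∧
      ∃ h : ℕ → ℕ, StrictMono h ∧
        ∀ x : X, ∀ᶠ n in Filter.atTop, x ∈ ⋃ k ∈ Ico (h n) (h (n + 1)), U k}

/-- The selection principle `S₁(𝒜, ℬ)`. -/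
def SelOne {X : Type u} (𝒜 ℬ : Set (Set (Set X))) : Prop :=
  ∀ 𝒰 : ℕ → Set (Set X), (∀ n, 𝒰 n ∈ 𝒜) →
    ∃ U : ℕ → Set X, (∀ n, U n ∈ 𝒰 n) ∧ range U ∈ ℬ

/-- Rothberger's property `S₁(O, O)`. -/
def IsRothberger (X : Type u) [TopologicalSpace X] : Prop :=
  SelOne (openCovers X) (openCovers X)

/-- The Gerlits–Nagy property `S₁(Ω, ℷ(Γ))`. -/
def IsGerlitsNagy (X : Type u) [TopologicalSpace X] : Prop :=
  SelOne (omegaCovers X) (gimelGammaCovers X)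

/-- The class of spaces whose product with every (infinite, Lindelöf) Gerlits–Nagy space is
Rothberger. -/
def GerlitsNagyToRothberger (X : Type u) [TopologicalSpace X] : Prop :=
  ∀ (Y : Type v) [TopologicalSpace Y] [Infinite Y] [LindelofSpace Y],
    IsGerlitsNagy Y → IsRothberger (X × Y)

/-- `X` is `κ`-concentrated: there is a countable `D ⊆ X` such that the complement of every open
set containing `D` has cardinality less than `κ`. -/
def IsConcentrated (κ : Cardinal.{u}) (X : Type u) [TopologicalSpace X] : Prop :=
  ∃ D : Set X, D.Countable ∧ ∀ U : Set X, IsOpen U → D ⊆ U → #↥Uᶜ < κ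

/-- `cov(M)`: the least number of meager subsets of the real line that cover the real line. -/
noncomputable def covMeager : Cardinal.{0} :=
  sInf {κ | ∃ 𝓕 : Set (Set ℝ), (∀ A ∈ 𝓕, IsMeagre A) ∧ ⋃₀ 𝓕 = univ ∧ #𝓕 = κ}

/-- The cardinals `κ` such that some infinite regular space that is not in the class
`GerlitsNagyToRothberger` is the union of `κ` many (infinite) `μ`-concentrated subspaces. -/
def badUnionNumbers (μ : Cardinal.{u}) : Set Cardinal.{u} :=
  {κ | ∃ (X : Type u) (_ : TopologicalSpace X) (ι : Type u) (C : ι → Set X),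
    Infinite X ∧ RegularSpace X ∧ #ι = κ ∧
    (∀ i, (C i).Infinite ∧ IsConcentrated μ (C i)) ∧ ⋃ i, C i = univ ∧
    ¬ GerlitsNagyToRothberger.{u, v} X}

/-! Bartoszyński's theorem says that `covMeager` is the least size of a family of functions that no
single function matches infinitely often. For smaller families, one function can even match
prescribed values on infinitely many whole finite blocks (`InfinitelyMatchable.exists_block_match`).

Blocks are what a Gerlits–Nagy factor `Y` supplies. For a sequence `d` in `X` and open covers of `X
× Y`, any selection agreeing with a suitable one on infinitely many blocks covers `G × Y` for some
Gδ set `G` containing `d` (`IsGerlitsNagy.exists_block_cover_prod`). With fewer than `covMeager`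
concentrated pieces, one selection serves all pieces at once. The points missed form countably many
sets, each a union of one small set per piece; if each has fewer than `covMeager` points, a further
selection covers its product with `Y` (`IsGerlitsNagy.isRothberger_prod`). So the lower bounds
reduce to cardinal arithmetic.

For the upper bounds, a non-Rothberger set of at most `covMeager` reals is cut into countable
pieces, or into cofinality many pieces of size below `covMeager`. -/

/-! ### Infinitely often matching, for values and for blocks -/

/-- Every family of functions `ℕ → ℕ` indexed by `ι` is matched infinitely often by a single
function. -/
def InfinitelyMatchable (ι : Type u) : Prop :=
  ∀ F : ι → ℕ → ℕ, ∃ g : ℕ → ℕ, ∀ i, ∃ᶠ n in Filter.atTop, g n = F i n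

theorem InfinitelyMatchable.of_countable_codomain {ι : Type u} (h : InfinitelyMatchable ι)
    {E : Type*} [Countable E] [Nonempty E] (F : ι → ℕ → E) :
    ∃ g : ℕ → E, ∀ i, ∃ᶠ n in Filter.atTop, g n = F i n := by
  obtain ⟨e, he⟩ := exists_injective_nat E
  obtain ⟨g, hg⟩ := h fun i n => e (F i n)
  refine ⟨fun n => Function.invFun e (g n), fun i => (hg i).mono fun n hn => ?_⟩
  simp only [hn]
  exact Function.leftInverse_invFun he _

/-- Greedy choice: the at most `n` numbers already chosen, with their neighbours, exclude at most `3
* n` candidates. -/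
theorem exists_seq_mem_pairwise_apart (L : ℕ → Finset ℕ) (hL : ∀ n, 3 * n < (L n).card) :
    ∃ a : ℕ → ℕ, (∀ n, a n ∈ L n) ∧
      ∀ m n, m < n → a m + 1 < a n ∨ a n + 1 < a m := by
  have key : ∀ (n : ℕ) (p : Finset ℕ), ∃ x, p.card ≤ n →
      x ∈ L n ∧ ∀ y ∈ p, y + 1 < x ∨ x + 1 < y := by
    intro n p
    by_cases hp : p.card ≤ n
    · have hc : (p.biUnion fun y => ({y - 1, y, y + 1} : Finset ℕ)).card ≤ p.card * 3 :=
        Finset.card_biUnion_le_card_mul _ _ _ fun y _ => Finset.card_le_three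
      obtain ⟨x, hx, hx'⟩ := Finset.exists_mem_notMem_of_card_lt_card
        (lt_of_le_of_lt hc (lt_of_le_of_lt (by omega) (hL n)))
      refine ⟨x, fun _ => ⟨hx, fun y hy => ?_⟩⟩
      simp only [Finset.mem_biUnion, Finset.mem_insert, Finset.mem_singleton, not_exists,
        not_and, not_or] at hx'
      have := hx' y hy
      omega
    · exact ⟨0, fun h => absurd h hp⟩
  choose pick hpick using key
  let P : ℕ → Finset ℕ := fun n => Nat.rec ∅ (fun n p => insert (pick n p) p) n
  have hP : ∀ n, P (n + 1) = insert (pick n (P n)) (P n) := fun n => rfl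
  have hcard : ∀ n, (P n).card ≤ n := by
    intro n
    induction n with
    | zero => simp [P]
    | succ n ih => rw [hP]; exact (Finset.card_insert_le _ _).trans (by omega)
  have hmem : ∀ m n, m < n → pick m (P m) ∈ P n := by
    intro m n hmn
    induction n, hmn using Nat.le_induction with
    | base => rw [hP]; exact Finset.mem_insert_self _ _
    | succ n _ ih => rw [hP]; exact Finset.mem_insert_of_mem ih
  exact ⟨fun n => pick n (P n), fun n => (hpick n _ (hcard n)).1,
    fun m n hmn => (hpick n _ (hcard n)).2 _ (hmem m n hmn)⟩

/-- There is an interval partition such that, for each `i`, infinitely many pairs of adjacent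
intervals contain a block of the `i`-th sequence of blocks. -/
theorem InfinitelyMatchable.exists_interval_partition {ι : Type u} (h : InfinitelyMatchable ι)
    (R : ι → ℕ → Finset ℕ) :
    ∃ c : ℕ → ℕ, StrictMono c ∧
      ∀ i, {n | ∃ k, c n ≤ k ∧ ∀ m ∈ R i k, m < c (n + 2)}.Infinite := by
  obtain ⟨ψ, hψ⟩ := h fun i k => (R i k).sup id + 1
  let Ψ : ℕ → ℕ := fun k => k + 1 + ∑ j ∈ Finset.range (k + 1), ψ j
  have hΨmono : Monotone Ψ := fun a b hab => by
    have : ∑ j ∈ Finset.range (a + 1), ψ j ≤ ∑ j ∈ Finset.range (b + 1), ψ j :=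
      Finset.sum_le_sum_of_subset (Finset.range_mono (by omega))
    simp only [Ψ]
    omega
  have hΨψ : ∀ k, ψ k ≤ Ψ k := fun k => by
    have : ψ k ≤ ∑ j ∈ Finset.range (k + 1), ψ j :=
      Finset.single_le_sum (f := ψ) (fun _ _ => Nat.zero_le _) (by simp)
    simp only [Ψ]
    omega
  -- If `k` lies in `[c n, c (n + 1))` and `ψ` bounds the `k`-th block correctly, that block ends
  -- before `Ψ k ≤ Ψ (c (n + 1)) = c (n + 2)`.
  let c : ℕ → ℕ := fun n => Ψ^[n] 0
  have hc : ∀ n, c (n + 1) = Ψ (c n) := fun n => Function.iterate_succ_apply' _ _ _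
  have hcm : StrictMono c := strictMono_nat_of_lt_succ fun n => by
    rw [hc]
    simp only [Ψ]
    omega
  refine ⟨c, hcm, fun i => Set.infinite_of_forall_exists_gt fun N => ?_⟩
  obtain ⟨k, hk, hkψ⟩ := (Filter.frequently_atTop.1 (hψ i)) (c (N + 1))
  have hex : ∃ n, k < c n := ⟨k + 1, lt_of_lt_of_le (Nat.lt_succ_self k) (hcm.id_le _)⟩
  obtain ⟨n, hn⟩ : ∃ n, Nat.find hex = n + 1 :=
    Nat.exists_eq_succ_of_ne_zero fun h0 => by
      have := Nat.find_spec hex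
      rw [h0] at this
      simp [c] at this
  have h1 : k < c (n + 1) := hn ▸ Nat.find_spec hex
  have h2 : c n ≤ k := not_lt.1 (Nat.find_min hex (m := n) (by omega))
  refine ⟨n, ⟨k, h2, fun m hm => ?_⟩, ?_⟩
  · have h3 : m ≤ (R i k).sup id := Finset.le_sup (f := id) hm
    have h4 : Ψ k ≤ c (n + 2) := by rw [hc (n + 1)]; exact hΨmono h1.le
    have h5 := hΨψ k
    omega
  · have := hcm.lt_iff_lt.1 (lt_of_le_of_lt hk h1)
    omega

/-- A guess at stage `n` proposes `3 * n + 1` places at which the `i`-th sequence has a block, with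
the values there. Enough places are proposed that one per stage can be kept with disjoint windows,
so all guesses merge into one function. -/
theorem InfinitelyMatchable.exists_block_match {ι : Type u} (h : InfinitelyMatchable ι)
    (R : ι → ℕ → Finset ℕ) (hR : ∀ i k, ∀ n ∈ R i k, k ≤ n) (x : ι → ℕ → ℕ → ℕ) :
    ∃ f : ℕ → ℕ, ∀ i, ∃ᶠ k in Filter.atTop, ∀ n ∈ R i k, f n = x i k n := by
  classical
  obtain ⟨c, hc, hA⟩ := h.exists_interval_partition R
  choose! κ hκ using fun i n (hn : n ∈ {n | ∃ k, c n ≤ k ∧ ∀ m ∈ R i k, m < c (n + 2)}) => hn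
  choose S hSA hSc using fun i n => (hA i).exists_subset_card_eq (3 * n + 1)
  let D : ι → ℕ → Finset (ℕ × ℕ) := fun i n =>
    (S i n).biUnion fun a => (R i (κ i a)).image fun m => (a, m)
  obtain ⟨G, hG⟩ := h.of_countable_codomain (E := Finset ℕ × (ℕ × ℕ →₀ ℕ)) fun i n =>
    (S i n, Finsupp.indicator (D i n) fun p _ => x i (κ i p.1) p.2)
  obtain ⟨a, haL, ha⟩ := exists_seq_mem_pairwise_apart
    (fun n => if 3 * n < (G n).1.card then (G n).1 else Finset.range (3 * n + 1)) (by
      intro n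
      split_ifs with hn
      · exact hn
      · simp)
  have hainj : Function.Injective a := fun m n hmn => by
    rcases lt_trichotomy m n with hlt | heq | hgt
    · have := ha m n hlt; omega
    · exact heq
    · have := ha n m hgt; omega
  -- Each window spans two adjacent intervals, so indices at distance at least 2 give disjoint
  -- windows.
  have huniq : ∀ m n k, c (a m) ≤ k → k < c (a m + 2) → c (a n) ≤ k → k < c (a n + 2) →
      m = n := by
    intro m n k h1 h2 h3 h4
    have h5 := hc.lt_iff_lt.1 (lt_of_le_of_lt h1 h4)
    have h6 := hc.lt_iff_lt.1 (lt_of_le_of_lt h3 h2)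
    rcases lt_trichotomy m n with hlt | heq | hgt
    · have := ha m n hlt; omega
    · exact heq
    · have := ha n m hgt; omega
  let f : ℕ → ℕ := fun m =>
    if hm : ∃ n, c (a n) ≤ m ∧ m < c (a n + 2) then (G hm.choose).2 (a hm.choose, m) else 0
  refine ⟨f, fun i => Filter.frequently_atTop.2 fun K => ?_⟩
  obtain ⟨n, hn, hnK⟩ := ((hG i).and_eventually
    (hainj.nat_tendsto_atTop.eventually_ge_atTop K)).exists
  have han : a n ∈ S i n := by
    have := haL n
    rw [hn] at this
    simpa [hSc] using this
  obtain ⟨hk1, hk2⟩ := hκ i (a n) (hSA i n han)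
  refine ⟨κ i (a n), hnK.trans ((hc.id_le _).trans hk1), fun m hm => ?_⟩
  have h1 : c (a n) ≤ m := hk1.trans (hR i _ m hm)
  have h2 := hk2 m hm
  have hex : ∃ n, c (a n) ≤ m ∧ m < c (a n + 2) := ⟨n, h1, h2⟩
  have hch : hex.choose = n := huniq _ _ m hex.choose_spec.1 hex.choose_spec.2 h1 h2
  have : f m = (G n).2 (a n, m) := by
    simp only [f, dif_pos hex, hch]
  rw [this, hn]
  have hD : (a n, m) ∈ D i n :=
    Finset.mem_biUnion.2 ⟨a n, han, Finset.mem_image.2 ⟨m, hm, rfl⟩⟩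
  exact Finsupp.indicator_of_mem hD (fun p _ => x i (κ i p.1) p.2)

/-! ### Matching and the covering number of the meager ideal -/

theorem exists_isOpen_floor_inv_fract_eq (x : ℝ) (a n : ℕ) {ε : ℝ} (hn : ((2 : ℝ) ^ n)⁻¹ < ε) :
    ∃ V : Set ℝ, IsOpen V ∧ (V ∩ Metric.ball x ε).Nonempty ∧
      ∀ y ∈ V, ⌊(Int.fract (2 ^ n * y))⁻¹⌋₊ = a + 1 := by
  have h2 : (0 : ℝ) < 2 ^ n := by positivity
  let z : ℤ := ⌊2 ^ n * x⌋
  have hlt : ((a : ℝ) + 2)⁻¹ < ((a : ℝ) + 1)⁻¹ :=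
    inv_strictAnti₀ (by positivity) (by linarith)
  obtain ⟨t, ht1, ht2⟩ := exists_between hlt
  have ht0 : 0 < t := lt_trans (by positivity) ht1
  have ha1 : ((a : ℝ) + 1)⁻¹ ≤ 1 := inv_le_one_of_one_le₀ (by linarith [a.cast_nonneg (α := ℝ)])
  refine ⟨(fun y : ℝ => 2 ^ n * y - z) ⁻¹' Ioo ((a : ℝ) + 2)⁻¹ ((a : ℝ) + 1)⁻¹,
    isOpen_Ioo.preimage (by fun_prop), ⟨(z + t) / 2 ^ n, ?_, ?_⟩, fun y hy => ?_⟩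
  · simp only [mem_preimage]
    rw [mul_div_cancel₀ _ h2.ne']
    simpa using ⟨ht1, ht2⟩
  · have hz1 : (z : ℝ) ≤ 2 ^ n * x := Int.floor_le _
    have hz2 : 2 ^ n * x < z + 1 := Int.lt_floor_add_one _
    rw [Metric.mem_ball, Real.dist_eq]
    have : (z + t) / 2 ^ n - x = (z + t - 2 ^ n * x) * (2 ^ n)⁻¹ := by field_simp
    rw [this, abs_mul, abs_of_pos (inv_pos.2 h2)]
    refine lt_of_le_of_lt (mul_le_of_le_one_left (inv_pos.2 h2).le ?_) hn
    rw [abs_le]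
    constructor <;> linarith
  · obtain ⟨hy1, hy2⟩ := hy
    have hpos : 0 < 2 ^ n * y - z := lt_trans (by positivity) hy1
    have hfr : Int.fract (2 ^ n * y) = 2 ^ n * y - z := by
      rw [Int.fract_eq_iff]
      exact ⟨hpos.le, by linarith, z, by ring⟩
    rw [hfr, Nat.floor_eq_iff (inv_nonneg.2 hpos.le)]
    constructor
    · rw [le_inv_comm₀ (by positivity) hpos]
      push_cast
      exact hy2.le
    · rw [inv_lt_comm₀ hpos (by positivity)]
      push_cast
      rw [add_assoc, one_add_one_eq_two]
      exact hy1

/-- The map reads a sequence of naturals off a real. Its `n`-th term takes every value on an open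
subset of each dyadic interval of length `2⁻ⁿ`, so a generic real matches `F` infinitely often. -/
theorem residual_frequently_floor_inv_fract_eq (F : ℕ → ℕ) :
    {x : ℝ | ∃ᶠ n in Filter.atTop, ⌊(Int.fract (2 ^ n * x))⁻¹⌋₊ - 1 = F n} ∈ residual ℝ := by
  have key : ∀ N, interior {x : ℝ | ∃ n ≥ N, ⌊(Int.fract (2 ^ n * x))⁻¹⌋₊ - 1 = F n} ∈
      residual ℝ := by
    intro N
    refine residual_of_dense_open isOpen_interior (Metric.dense_iff.2 fun x ε hε => ?_)
    obtain ⟨m, hm⟩ := exists_pow_lt_of_lt_one hε (show (2⁻¹ : ℝ) < 1 by norm_num)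
    have hn : ((2 : ℝ) ^ max N m)⁻¹ < ε := by
      rw [← inv_pow]
      exact (pow_le_pow_of_le_one (by norm_num) (by norm_num) (le_max_right _ _)).trans_lt hm
    obtain ⟨V, hV, ⟨y, hyV, hyb⟩, hVF⟩ := exists_isOpen_floor_inv_fract_eq x (F (max N m)) _ hn
    have hsub : V ⊆ {x : ℝ | ∃ n ≥ N, ⌊(Int.fract (2 ^ n * x))⁻¹⌋₊ - 1 = F n} :=
      fun z hz => ⟨max N m, le_max_left _ _, by rw [hVF z hz]; rfl⟩
    exact ⟨y, hyb, interior_maximal hsub hV hyV⟩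
  filter_upwards [countable_iInter_mem.2 key] with x hx
  refine Filter.frequently_atTop.2 fun N => ?_
  have := interior_subset (mem_iInter.1 hx N)
  exact this

theorem infinitelyMatchable_of_lt_covMeager {ι : Type u} (h : #ι < Cardinal.lift.{u} covMeager) :
    InfinitelyMatchable ι := by
  intro F
  let A : ι → Set ℝ := fun i =>
    {x : ℝ | ∃ᶠ n in Filter.atTop, ⌊(Int.fract (2 ^ n * x))⁻¹⌋₊ - 1 = F i n}ᶜ
  have hA : ⋃₀ range A ≠ univ := by
    intro hA
    have h1 : covMeager ≤ #(range A) := csInf_le' ⟨range A, by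
      rintro _ ⟨i, rfl⟩
      simpa [A, IsMeagre] using residual_frequently_floor_inv_fract_eq (F i), hA, rfl⟩
    have h2 : Cardinal.lift.{u} #(range A) ≤ Cardinal.lift.{0} #ι := Cardinal.mk_range_le_lift
    rw [Cardinal.lift_uzero] at h2
    exact (h.trans_le ((Cardinal.lift_le.2 h1).trans h2)).false
  obtain ⟨x, hx⟩ := (ne_univ_iff_exists_notMem _).1 hA
  refine ⟨fun n => ⌊(Int.fract (2 ^ n * x))⁻¹⌋₊ - 1, fun i => ?_⟩
  by_contra hi
  exact hx ⟨A i, mem_range_self i, hi⟩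

theorem exists_ofDigits_cylinder_disjoint {T : Set ℝ} (hT : IsClosed T) (hT' : interior T = ∅)
    (x : ℕ → Fin 2) (e : ℕ) :
    ∃ e' ≥ e, ∃ x' : ℕ → Fin 2, (∀ i < e, x' i = x i) ∧
      ∀ c : ℕ → Fin 2, (∀ i < e', c i = x' i) → Real.ofDigits c ∉ T := by
  have h2 : (0 : ℝ) < 2 ^ e := by positivity
  let q : ℝ := ∑ i ∈ Finset.range e, Real.ofDigitsTerm x i
  obtain ⟨p, hp, hpT⟩ : ∃ p ∈ Ioo q (q + (2 ^ e)⁻¹), p ∉ T := by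
    by_contra! hsub
    have : q + (2 ^ e)⁻¹ / 2 ∈ interior T :=
      interior_maximal hsub isOpen_Ioo ⟨by linarith [inv_pos.2 h2], by linarith [inv_pos.2 h2]⟩
    rw [hT'] at this
    exact this
  obtain ⟨ε, hε, hball⟩ := Metric.isOpen_iff.1 hT.isOpen_compl p hpT
  obtain ⟨m, hm⟩ := exists_pow_lt_of_lt_one hε (show (2⁻¹ : ℝ) < 1 by norm_num)
  let u : ℝ := (p - q) * 2 ^ e
  have hu : u ∈ Ico (0 : ℝ) 1 := by
    refine ⟨mul_nonneg (by linarith [hp.1]) h2.le, ?_⟩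
    rw [← lt_div_iff₀ h2, one_div]
    linarith [hp.2]
  let x' : ℕ → Fin 2 := fun i => if i < e then x i else Real.digits u 2 (i - e)
  have hx' : Real.ofDigits x' = p := by
    rw [Real.ofDigits_eq_sum_add_ofDigits x' e]
    have h3 : ∑ i ∈ Finset.range e, Real.ofDigitsTerm x' i = q :=
      Finset.sum_congr rfl fun i hi => by
        simp [Real.ofDigitsTerm, x', Finset.mem_range.1 hi]
    have h4 : (fun i => x' (i + e)) = Real.digits u 2 := by
      funext i
      simp [x']
    rw [h3, h4, Real.ofDigits_digits one_lt_two hu]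
    simp only [u]
    push_cast
    field_simp
    ring
  refine ⟨max e m, le_max_left _ _, x', fun i hi => by simp [x', hi], fun c hc => ?_⟩
  refine hball (Metric.mem_ball.2 ?_)
  rw [Real.dist_eq, ← hx']
  refine (Real.abs_ofDigits_sub_ofDigits_le hc).trans_lt (lt_of_le_of_lt ?_ hm)
  rw [← inv_pow]
  push_cast
  exact pow_le_pow_of_le_one (by norm_num) (by norm_num) (le_max_right _ _)

/-- Only finitely many prefixes of length `k` exist. Treating them one after another, each time
lengthening a common block, gives digits that avoid the sets whatever the prefix. -/
theorem exists_ofDigits_block_disjoint {T : ℕ → Set ℝ} (hT : ∀ n, IsClosed (T n))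
    (hT' : ∀ n, interior (T n) = ∅) (k : ℕ) :
    ∃ (e : ℕ) (x : ℕ → Fin 2), ∀ c : ℕ → Fin 2, (∀ i ∈ Finset.Ico k e, c i = x i) →
      ∀ n ≤ k, Real.ofDigits c ∉ T n := by
  classical
  have key : ∀ S : Finset ((ℕ → Fin 2) × ℕ), ∃ e ≥ k, ∃ x : ℕ → Fin 2, ∀ s ∈ S,
      ∀ c : ℕ → Fin 2, (∀ i < k, c i = s.1 i) → (∀ i ∈ Finset.Ico k e, c i = x i) →
        Real.ofDigits c ∉ T s.2 := by
    intro S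
    induction S using Finset.induction_on with
    | empty => exact ⟨k, le_rfl, fun _ => 0, by simp⟩
    | insert s S _ ih =>
      obtain ⟨e, he, x, hx⟩ := ih
      obtain ⟨e', he', x', hxx', hx'⟩ := exists_ofDigits_cylinder_disjoint (hT s.2) (hT' s.2)
        (fun i => if i < k then s.1 i else x i) e
      refine ⟨e', he.trans he', x', fun t ht c hct hcx => ?_⟩
      rcases Finset.mem_insert.1 ht with rfl | ht
      · refine hx' c fun i hi => ?_
        by_cases hik : i < k
        · rw [hct i hik, hxx' i (hik.trans_le he), if_pos hik]
        · exact hcx i (Finset.mem_Ico.2 ⟨not_lt.1 hik, hi⟩)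
      · refine hx t ht c hct fun i hi => ?_
        obtain ⟨hik, hie⟩ := Finset.mem_Ico.1 hi
        rw [hcx i (Finset.mem_Ico.2 ⟨hik, hie.trans_le he'⟩), hxx' i hie, if_neg (not_lt.2 hik)]
  let ext : (Fin k → Fin 2) → ℕ → Fin 2 := fun s i => if h : i < k then s ⟨i, h⟩ else 0
  obtain ⟨e, _, x, hx⟩ := key ((Finset.univ.image ext) ×ˢ Finset.range (k + 1))
  refine ⟨e, x, fun c hc n hn => ?_⟩
  refine hx (ext fun i => c i, n) ?_ c (fun i hi => by simp [ext, hi]) hc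
  simp only [Finset.mem_product, Finset.mem_range]
  exact ⟨Finset.mem_image_of_mem _ (Finset.mem_univ _), by omega⟩

theorem IsMeagre.exists_isClosed_interior_eq_empty {Z : Type*} [TopologicalSpace Z] {A : Set Z}
    (hA : IsMeagre A) :
    ∃ T : ℕ → Set Z, (∀ n, IsClosed (T n)) ∧ (∀ n, interior (T n) = ∅) ∧ A ⊆ ⋃ n, T n := by
  obtain ⟨S, hS, hSc, hAS⟩ := isMeagre_iff_countable_union_isNowhereDense.1 hA
  obtain ⟨t, ht⟩ := (hSc.insert ∅).exists_eq_range (insert_nonempty _ _)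
  refine ⟨fun n => closure (t n), fun n => isClosed_closure, fun n => ?_, fun a ha => ?_⟩
  · have : t n ∈ insert ∅ S := ht ▸ mem_range_self n
    rcases this with h | h
    · simp [h]
    · exact hS _ h
  · obtain ⟨s, hs, has⟩ := hAS ha
    have : s ∈ range t := ht ▸ mem_insert_of_mem _ hs
    obtain ⟨n, rfl⟩ := this
    exact mem_iUnion.2 ⟨n, subset_closure has⟩

theorem exists_mk_eq_covMeager_not_infinitelyMatchable :
    ∃ ι : Type, #ι = covMeager ∧ ¬ InfinitelyMatchable ι := by
  have hne : {κ | ∃ 𝓕 : Set (Set ℝ), (∀ A ∈ 𝓕, IsMeagre A) ∧ ⋃₀ 𝓕 = univ ∧ #𝓕 = κ}.Nonempty := by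
    refine ⟨_, range fun x : ℝ => ({x} : Set ℝ), ?_, ?_, rfl⟩
    · rintro _ ⟨x, rfl⟩
      exact IsNowhereDense.isMeagre (by simp [IsNowhereDense])
    · exact eq_univ_of_forall fun x => ⟨{x}, mem_range_self x, rfl⟩
  obtain ⟨𝓕, hM, hcov, hcard⟩ := csInf_mem hne
  refine ⟨𝓕, hcard, fun hmatch => ?_⟩
  choose T hTc hTi hAT using fun A : 𝓕 => (hM A A.2).exists_isClosed_interior_eq_empty
  choose e x hx using fun A : 𝓕 => exists_ofDigits_block_disjoint (hTc A) (hTi A)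
  obtain ⟨f, hf⟩ := hmatch.exists_block_match (fun A k => Finset.Ico k (e A k))
    (fun A k n hn => (Finset.mem_Ico.1 hn).1) fun A k n => x A k n
  -- Reduction mod 2 leaves the matched digits unchanged.
  let c : ℕ → Fin 2 := fun n => Fin.ofNat 2 (f n)
  have hc : Real.ofDigits c ∈ ⋃₀ 𝓕 := hcov ▸ mem_univ _
  obtain ⟨A, hA, hcA⟩ := hc
  obtain ⟨n, hn⟩ := mem_iUnion.1 (hAT ⟨A, hA⟩ hcA)
  obtain ⟨k, hk, hkf⟩ := Filter.frequently_atTop.1 (hf ⟨A, hA⟩) n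
  refine hx ⟨A, hA⟩ k c (fun i hi => ?_) n hk hn
  simp only [c, hkf i hi]
  exact Fin.ofNat_val_eq_self _

theorem aleph0_lt_covMeager : ℵ₀ < covMeager := by
  obtain ⟨ι, hι, hnot⟩ := exists_mk_eq_covMeager_not_infinitelyMatchable
  rw [← hι]
  by_contra! hle
  have : Countable ι := Cardinal.mk_le_aleph0_iff.1 hle
  refine hnot fun F => ?_
  rcases isEmpty_or_nonempty ι with _ | _
  · exact ⟨fun _ => 0, fun i => isEmptyElim i⟩
  obtain ⟨s, hs⟩ := exists_surjective_nat ι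
  refine ⟨fun n => F (s n.unpair.1) n, fun i => Filter.frequently_atTop.2 fun N => ?_⟩
  obtain ⟨m, rfl⟩ := hs i
  exact ⟨Nat.pair m N, Nat.right_le_pair _ _, by simp⟩

/-! ### Products with a Gerlits–Nagy space -/

/-- In a Gerlits–Nagy space, one can select from a sequence of countable open covers along finite
blocks so that each point is covered by all but finitely many blocks. -/
theorem IsGerlitsNagy.exists_block_cover {Y : Type v} [TopologicalSpace Y] (hY : IsGerlitsNagy Y)
    (V : ℕ → ℕ → Set Y) (hV : ∀ n j, IsOpen (V n j)) (hcov : ∀ n y, ∃ j, y ∈ V n j) :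
    ∃ (R : ℕ → Finset ℕ) (x : ℕ → ℕ → ℕ), (∀ k, ∀ n ∈ R k, k ≤ n) ∧
      ∀ y, ∀ᶠ k in Filter.atTop, ∃ n ∈ R k, y ∈ V n (x k n) := by
  classical
  by_cases hfin : ∀ N : ℕ, ∃ (P : Finset ℕ) (g : ℕ → ℕ), (∀ n ∈ P, N ≤ n) ∧
      ∀ y, ∃ n ∈ P, y ∈ V n (g n)
  · choose R x hR hx using hfin
    exact ⟨R, x, hR, fun y => Filter.Eventually.of_forall fun k => hx k y⟩
  -- From some `N` on, no finite selection covers `Y`. This keeps the finite unions `W p l`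
  -- different from `univ`, as members of an ω-cover must be.
  push Not at hfin
  obtain ⟨N, hN⟩ := hfin
  let W : ℕ → List ℕ → Set Y := fun p l =>
    {y | ∃ i < l.length, y ∈ V (N + Nat.pair p i) (l.getD i 0)}
  have hWω : ∀ (p : ℕ) (F : Set Y), F.Finite → ∃ l, F ⊆ W p l := by
    intro p F hF
    induction F, hF using Set.Finite.induction_on with
    | empty => exact ⟨[], empty_subset _⟩
    | @insert a F _ _ ih =>
      obtain ⟨l, hl⟩ := ih
      obtain ⟨j, hj⟩ := hcov (N + Nat.pair p l.length) a
      refine ⟨l ++ [j], insert_subset ⟨l.length, by simp, by simpa using hj⟩ fun y hy => ?_⟩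
      obtain ⟨i, hi, hyi⟩ := hl hy
      refine ⟨i, by simp; omega, ?_⟩
      rwa [List.getD_append _ _ _ _ hi]
  have hmem : ∀ p, range (W p) ∈ omegaCovers Y := by
    intro p
    refine ⟨⟨countable_range _, ?_, ?_, ?_⟩, fun F hF => ?_⟩
    · rintro _ ⟨l, rfl⟩
      have : W p l = ⋃ i ∈ {i | i < l.length}, V (N + Nat.pair p i) (l.getD i 0) := by
        ext y
        simp [W]
      rw [this]
      exact isOpen_biUnion fun i _ => hV _ _
    · refine eq_univ_of_forall fun y => ?_
      obtain ⟨l, hl⟩ := hWω p {y} (finite_singleton y)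
      exact ⟨W p l, mem_range_self l, hl rfl⟩
    · rintro ⟨l, hl⟩
      obtain ⟨y, hy⟩ := hN ((Finset.range l.length).image fun i => N + Nat.pair p i)
        (fun n => l.getD (n - N).unpair.2 0) (fun n hn => by
          obtain ⟨i, _, rfl⟩ := Finset.mem_image.1 hn
          exact Nat.le_add_right _ _)
      obtain ⟨i, hi, hyi⟩ : y ∈ W p l := hl ▸ mem_univ y
      refine hy _ (Finset.mem_image_of_mem _ (Finset.mem_range.2 hi)) ?_
      simpa using hyi
    · obtain ⟨l, hl⟩ := hWω p F hF
      exact ⟨W p l, mem_range_self l, hl⟩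
  obtain ⟨U, hU, _, E, hE, hEU, h, hh, hy⟩ := hY _ hmem
  choose l hl using hU
  have hq : ∀ k, ∃ p, U p = E k := fun k => by
    have : E k ∈ range U := hEU ▸ mem_range_self k
    exact this
  choose q hq using hq
  have hqinj : Function.Injective q := fun a b hab => hE (by rw [← hq, ← hq, hab])
  -- Skipping early blocks forces all indices in the `K`-th block to be at least `K`.
  have hν : ∀ K, ∃ n ≥ K, ∀ k ≥ n, K ≤ q k := fun K => by
    obtain ⟨M, hM⟩ := Filter.eventually_atTop.1
      (hqinj.nat_tendsto_atTop.eventually_ge_atTop K)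
    exact ⟨max K M, le_max_left _ _, fun k hk => hM k ((le_max_right _ _).trans hk)⟩
  choose ν hνK hνq using hν
  refine ⟨fun K => (Finset.Ico (h (ν K)) (h (ν K + 1))).biUnion fun k =>
    (Finset.range (l (q k)).length).image fun i => N + Nat.pair (q k) i,
    fun _ n => (l (n - N).unpair.1).getD (n - N).unpair.2 0, fun K n hn => ?_, fun y => ?_⟩
  · obtain ⟨k, hk, hn⟩ := Finset.mem_biUnion.1 hn
    obtain ⟨i, _, rfl⟩ := Finset.mem_image.1 hn
    have h1 := hνq K k ((hh.id_le _).trans (Finset.mem_Ico.1 hk).1)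
    have h2 := Nat.left_le_pair (q k) i
    omega
  · obtain ⟨n₀, hn₀⟩ := Filter.eventually_atTop.1 (hy y)
    refine Filter.eventually_atTop.2 ⟨n₀, fun K hK => ?_⟩
    obtain ⟨k, hk, hyk⟩ := mem_iUnion₂.1 (hn₀ (ν K) (hK.trans (hνK K)))
    rw [← hq, ← hl] at hyk
    obtain ⟨i, hi, hyi⟩ := hyk
    refine ⟨N + Nat.pair (q k) i, Finset.mem_biUnion.2 ⟨k, Finset.mem_Ico.2 hk,
      Finset.mem_image_of_mem _ (Finset.mem_range.2 hi)⟩, ?_⟩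
    simpa using hyi

/-- Given open covers of `X × Y`, with `Y` Lindelöf and Gerlits–Nagy, and a sequence `d` in `X`,
every selection that agrees with a suitable one on infinitely many blocks covers `G × Y` for some
`Gδ` set `G` that contains the sequence. -/
theorem IsGerlitsNagy.exists_block_cover_prod {X : Type u} {Y : Type v} [TopologicalSpace X]
    [TopologicalSpace Y] [Nonempty Y] [LindelofSpace Y] (hY : IsGerlitsNagy Y)
    (U : ℕ → ℕ → Set (X × Y)) (hU : ∀ n j, IsOpen (U n j)) (hcov : ∀ n z, ∃ j, z ∈ U n j)
    (d : ℕ → X) :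
    ∃ (R : ℕ → Finset ℕ) (x : ℕ → ℕ → ℕ), (∀ k, ∀ n ∈ R k, k ≤ n) ∧
      ∀ f : ℕ → ℕ, (∃ᶠ k in Filter.atTop, ∀ n ∈ R k, f n = x k n) →
        ∃ W : ℕ → Set X, (∀ m, IsOpen (W m)) ∧ (∀ m i, d i ∈ W m) ∧
          ∀ p, (∀ m, p ∈ W m) → ∀ y, ∃ n, (p, y) ∈ U n (f n) := by
  classical
  -- The cover numbered `Nat.pair n i` is reserved for the point `d i`.
  have hrect : ∀ (n i : ℕ) (y : Y), ∃ (m : ℕ) (A : Set X) (B : Set Y), IsOpen A ∧ IsOpen B ∧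
      d i ∈ A ∧ y ∈ B ∧ A ×ˢ B ⊆ U (Nat.pair n i) m := by
    intro n i y
    obtain ⟨m, hm⟩ := hcov (Nat.pair n i) (d i, y)
    obtain ⟨A, B, hA, hB, hd, hy, hAB⟩ := isOpen_prod_iff.1 (hU _ m) _ _ hm
    exact ⟨m, A, B, hA, hB, hd, hy, hAB⟩
  choose M A B hA hB hdA hyB hAB using hrect
  have hB' : ∀ n y, IsOpen (⋂ i ∈ Finset.range (n + 1), B n i y) := fun n y =>
    isOpen_biInter_finset fun i _ => hB n i y
  have hlind : ∀ n, ∃ t : ℕ → Y, ∀ y, ∃ j, y ∈ ⋂ i ∈ Finset.range (n + 1), B n i (t j) := by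
    intro n
    obtain ⟨s, hs, hsU⟩ := LindelofSpace.elim_nhds_subcover
      (fun y => ⋂ i ∈ Finset.range (n + 1), B n i y)
      fun y => (hB' n y).mem_nhds (mem_iInter₂.2 fun i _ => hyB n i y)
    have hne : s.Nonempty := by
      obtain ⟨y⟩ := ‹Nonempty Y›
      obtain ⟨z, hz, _⟩ := mem_iUnion₂.1 (hsU ▸ mem_univ y)
      exact ⟨z, hz⟩
    obtain ⟨t, rfl⟩ := hs.exists_eq_range hne
    refine ⟨t, fun y => ?_⟩
    obtain ⟨_, ⟨j, rfl⟩, hj⟩ := mem_iUnion₂.1 (hsU ▸ mem_univ y)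
    exact ⟨j, hj⟩
  choose t ht using hlind
  obtain ⟨R, x, hR, hx⟩ := hY.exists_block_cover
    (fun n j => ⋂ i ∈ Finset.range (n + 1), B n i (t n j)) (fun n j => hB' n _) ht
  refine ⟨fun k => (R k).biUnion fun n => (Finset.range (n + 1)).image fun i => Nat.pair n i,
    fun k q => M q.unpair.1 q.unpair.2 (t q.unpair.1 (x k q.unpair.1)), fun k q hq => ?_,
    fun f hf => ?_⟩
  · obtain ⟨n, hn, hq⟩ := Finset.mem_biUnion.1 hq
    obtain ⟨i, _, rfl⟩ := Finset.mem_image.1 hq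
    exact (hR k n hn).trans (Nat.left_le_pair _ _)
  · have hf' : ∃ᶠ k in Filter.atTop, ∀ n ∈ R k, ∀ i ≤ n,
        f (Nat.pair n i) = M n i (t n (x k n)) := hf.mono fun k hk n hn i hi => by
      have := hk (Nat.pair n i) (Finset.mem_biUnion.2 ⟨n, hn, Finset.mem_image_of_mem _
        (Finset.mem_range.2 (Nat.lt_succ_of_le hi))⟩)
      simpa using this
    -- `W m` collects neighbourhoods of `d i` from the matched blocks `k ≥ max m i`; since `i ≤ k ≤
    -- n` for `n ∈ R k`, the cover reserved for `d i` occurs in the block.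
    refine ⟨fun m => ⋃ (k : ℕ) (i : ℕ) (_ : m ≤ k ∧ i ≤ k ∧ ∀ n ∈ R k, ∀ i ≤ n,
        f (Nat.pair n i) = M n i (t n (x k n))), ⋂ n ∈ R k, A n i (t n (x k n)),
      fun m => ?_, fun m i => ?_, fun p hp y => ?_⟩
    · exact isOpen_iUnion fun k => isOpen_iUnion fun i => isOpen_iUnion fun _ =>
        isOpen_biInter_finset fun n _ => hA _ _ _
    · obtain ⟨k, hk, hkf⟩ := Filter.frequently_atTop.1 hf' (max m i)
      simp only [mem_iUnion]
      exact ⟨k, i, ⟨(le_max_left _ _).trans hk, (le_max_right _ _).trans hk, hkf⟩,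
        mem_iInter₂.2 fun n _ => hdA _ _ _⟩
    · obtain ⟨m, hm⟩ := Filter.eventually_atTop.1 (hx y)
      have hpm := hp m
      simp only [mem_iUnion] at hpm
      obtain ⟨k, i, ⟨hmk, hik, hkf⟩, hpA⟩ := hpm
      obtain ⟨n, hn, hyn⟩ := hm k hmk
      have hin : i ≤ n := hik.trans (hR k n hn)
      refine ⟨Nat.pair n i, ?_⟩
      rw [hkf n hn i hin]
      exact hAB _ _ _ ⟨mem_iInter₂.1 hpA n hn,
        mem_iInter₂.1 hyn i (Finset.mem_range.2 (Nat.lt_succ_of_le hin))⟩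

theorem IsGerlitsNagy.exists_cover_prod_of_infinitelyMatchable {X : Type u} {Y : Type v}
    [TopologicalSpace X] [TopologicalSpace Y] [Nonempty Y] [LindelofSpace Y]
    (hY : IsGerlitsNagy Y) {Z : Set X} (hZ : InfinitelyMatchable Z)
    (U : ℕ → ℕ → Set (X × Y)) (hU : ∀ n j, IsOpen (U n j)) (hcov : ∀ n z, ∃ j, z ∈ U n j) :
    ∃ f : ℕ → ℕ, ∀ p ∈ Z, ∀ y, ∃ n, (p, y) ∈ U n (f n) := by
  choose R x hR hx using fun z : Z => hY.exists_block_cover_prod U hU hcov fun _ => (z : X)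
  obtain ⟨f, hf⟩ := hZ.exists_block_match R hR x
  refine ⟨f, fun p hp => ?_⟩
  obtain ⟨W, _, hW, hcover⟩ := hx ⟨p, hp⟩ f (hf _)
  exact hcover p fun m => hW m 0

theorem IsGerlitsNagy.isRothberger_prod {X : Type u} {Y : Type v} [TopologicalSpace X]
    [TopologicalSpace Y] [Nonempty X] [Nonempty Y] [LindelofSpace Y] (hY : IsGerlitsNagy Y)
    {ι : Type u} (hι : InfinitelyMatchable ι) (C : ι → Set X) (hC : ⋃ i, C i = univ)
    (d : ι → ℕ → X)
    (hd : ∀ W : ι → Set X, (∀ i, IsOpen (W i)) → (∀ i n, d i n ∈ W i) →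
      InfinitelyMatchable (⋃ i, C i \ W i : Set X)) :
    IsRothberger (X × Y) := by
  intro 𝒰 h𝒰
  have hne : ∀ n, (𝒰 n).Nonempty := fun n => by
    rw [nonempty_iff_ne_empty]
    intro h0
    have := (h𝒰 n).2.2.1
    rw [h0, sUnion_empty] at this
    exact empty_ne_univ this
  choose U hU using fun n => (h𝒰 n).1.exists_eq_range (hne n)
  have hUmem : ∀ n j, U n j ∈ 𝒰 n := fun n j => by rw [hU]; exact mem_range_self j
  have hUo : ∀ n j, IsOpen (U n j) := fun n j => (h𝒰 n).2.1 _ (hUmem n j)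
  have hUc : ∀ n z, ∃ j, z ∈ U n j := fun n z => by
    have hz : z ∈ ⋃₀ 𝒰 n := (h𝒰 n).2.2.1 ▸ mem_univ z
    rw [hU] at hz
    obtain ⟨_, ⟨j, rfl⟩, hj⟩ := hz
    exact ⟨j, hj⟩
  choose R x hR hx using fun i => hY.exists_block_cover_prod (fun k => U (Nat.pair 0 k))
    (fun k => hUo _) (fun k => hUc _) (d i)
  obtain ⟨f₀, hf₀⟩ := hι.exists_block_match R hR x
  choose W hWo hdW hW using fun i => hx i f₀ (hf₀ i)
  choose f hf using fun m => hY.exists_cover_prod_of_infinitelyMatchable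
    (hd (fun i => W i m) (fun i => hWo i m) (fun i => hdW i m))
    (fun k => U (Nat.pair (m + 1) k)) (fun k => hUo _) (fun k => hUc _)
  have hcov : ∃ F : ℕ → ℕ, ∀ z, ∃ n, z ∈ U n (F n) := by
    -- Row 0 of the covers treats the Gδ sets; row `m + 1` treats the points missed by the `m`-th
    -- open sets.
    refine ⟨fun n => (Nat.casesOn n.unpair.1 f₀ f : ℕ → ℕ) n.unpair.2, fun ⟨p, y⟩ => ?_⟩
    obtain ⟨i, hi⟩ := mem_iUnion.1 (hC ▸ mem_univ p)
    by_cases hp : ∀ m, p ∈ W i m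
    · obtain ⟨n, hn⟩ := hW i p hp y
      exact ⟨Nat.pair 0 n, by simpa using hn⟩
    · push Not at hp
      obtain ⟨m, hm⟩ := hp
      obtain ⟨n, hn⟩ := hf m p (mem_iUnion.2 ⟨i, hi, hm⟩) y
      exact ⟨Nat.pair (m + 1) n, by simpa using hn⟩
  obtain ⟨F, hF⟩ := hcov
  refine ⟨fun n => U n (F n), fun n => hUmem n _, countable_range _, ?_, ?_, ?_⟩
  · rintro _ ⟨n, rfl⟩
    exact hUo _ _
  · refine eq_univ_of_forall fun z => ?_
    obtain ⟨n, hn⟩ := hF z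
    exact ⟨_, mem_range_self n, hn⟩
  · rintro ⟨n, hn⟩
    exact (h𝒰 n).2.2.2 (hn ▸ hUmem n (F n))

/-! ### A small space outside the class -/

/-- Choosing the `n`-th set to contain the first `n + 1` points, each point is missed by finitely
many chosen sets, so any enumeration works with blocks of length one. -/
theorem isGerlitsNagy_of_countable (Y : Type v) [TopologicalSpace Y] [Nonempty Y] [Countable Y] :
    IsGerlitsNagy Y := by
  intro 𝒰 h𝒰
  obtain ⟨e, he⟩ := exists_surjective_nat Y
  choose U hU hUe using fun n => (h𝒰 n).2 (e '' Iic n) ((finite_Iic n).image e)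
  have hcof : ∀ m n, m ≤ n → e m ∈ U n := fun m n hmn => hUe n (mem_image_of_mem e hmn)
  have hout : ∀ n, ∃ m, e m ∉ U n := fun n => by
    by_contra! hall
    refine (h𝒰 n).1.2.2.2 ?_
    have : U n = univ := eq_univ_of_forall fun y => by
      obtain ⟨m, rfl⟩ := he y
      exact hall m
    exact this ▸ hU n
  have hfin : ∀ y, {S ∈ range U | y ∉ S}.Finite := fun y => by
    obtain ⟨m, rfl⟩ := he y
    refine ((finite_Iio m).image U).subset ?_
    rintro _ ⟨⟨n, rfl⟩, hn⟩
    exact mem_image_of_mem U (not_le.1 fun hmn => hn (hcof m n hmn))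
  have hinf : (range U).Infinite := by
    intro hf
    have hbad : ∀ S ∈ range U, ∃ m, e m ∉ S := by
      rintro _ ⟨n, rfl⟩
      exact hout n
    choose! μ hμ using hbad
    obtain ⟨M, hM⟩ := (hf.image μ).bddAbove
    exact hμ (U M) (mem_range_self M)
      (hcof _ M (hM (mem_image_of_mem μ (mem_range_self M))))
  have hcover : range U ∈ openCovers Y := by
    refine ⟨countable_range _, ?_, eq_univ_of_forall fun y => ?_, ?_⟩
    · rintro _ ⟨n, rfl⟩
      exact (h𝒰 n).1.2.1 _ (hU n)
    · obtain ⟨m, rfl⟩ := he y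
      exact ⟨U m, mem_range_self m, hcof m m le_rfl⟩
    · rintro ⟨n, hn⟩
      exact (h𝒰 n).1.2.2.2 (hn ▸ hU n)
  have : Infinite (range U) := hinf.to_subtype
  have : Countable (range U) := (countable_range U).to_subtype
  obtain ⟨φ⟩ : Nonempty (ℕ ≃ range U) := nonempty_equiv_of_countable
  have hφ : Function.Injective fun n => (φ n : Set Y) := Subtype.val_injective.comp φ.injective
  refine ⟨U, hU, hcover, fun n => φ n, hφ, ?_, id, strictMono_id, fun y => ?_⟩
  · ext S
    constructor
    · rintro ⟨n, rfl⟩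
      exact (φ n).2
    · intro hS
      exact ⟨φ.symm ⟨S, hS⟩, by simp⟩
  · have : {n | y ∉ (φ n : Set Y)}.Finite :=
      ((hfin y).preimage hφ.injOn).subset fun n hn => ⟨(φ n).2, hn⟩
    have hev : ∀ᶠ n in Filter.atTop, y ∈ (φ n : Set Y) := by
      rw [← Nat.cofinite_eq_atTop]
      filter_upwards [this.compl_mem_cofinite] with n hn using not_not.1 hn
    exact hev.mono fun n hn => mem_iUnion₂.2 ⟨n, by simp, hn⟩

theorem exists_set_baire_forall_exists_ne :
    ∃ H : Set (ℕ → ℕ), #H ≤ covMeager ∧ ∀ g : ℕ → ℕ, ∃ h ∈ H, ∀ n, h n ≠ g n := by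
  obtain ⟨ι, hι, hnot⟩ := exists_mk_eq_covMeager_not_infinitelyMatchable
  unfold InfinitelyMatchable at hnot
  push Not at hnot
  obtain ⟨F, hF⟩ := hnot
  -- Changing finite initial segments turns "eventually different" into "everywhere different"
  -- without raising the cardinality above `covMeager`.
  refine ⟨range fun p : ι × List ℕ => fun n => if n < p.2.length then p.2.getD n 0 else F p.1 n,
    ?_, fun g => ?_⟩
  · refine Cardinal.mk_range_le.trans ?_
    rw [Cardinal.mk_prod, Cardinal.lift_id, Cardinal.lift_id, hι]
    exact Cardinal.mul_le_of_le aleph0_lt_covMeager.le le_rfl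
      (Cardinal.mk_le_aleph0.trans aleph0_lt_covMeager.le)
  · obtain ⟨i, hi⟩ := hF g
    obtain ⟨N, hN⟩ := Filter.eventually_atTop.1 hi
    refine ⟨_, ⟨(i, List.ofFn fun n : Fin N => g n + 1), rfl⟩, fun n => ?_⟩
    by_cases hn : n < N
    · simp [hn]
    · simpa [hn] using Ne.symm (hN n (not_lt.1 hn))

theorem exists_regularSpace_not_isRothberger_prod :
    ∃ (X : Type u) (_ : TopologicalSpace X), Infinite X ∧ RegularSpace X ∧
      #X ≤ Cardinal.lift.{u} covMeager ∧
      ∀ (Y : Type v) [TopologicalSpace Y] [Nonempty Y], ¬ IsRothberger (X × Y) := by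
  obtain ⟨H, hH, hne⟩ := exists_set_baire_forall_exists_ne
  refine ⟨ULift.{u} H, inferInstance, ?_, inferInstance, ?_, ?_⟩
  · refine not_finite_iff_infinite.1 fun hfin => ?_
    have : Finite H := Finite.of_equiv _ Equiv.ulift
    have : Nonempty H := by
      obtain ⟨h, hh, _⟩ := hne 0
      exact ⟨⟨h, hh⟩⟩
    obtain ⟨s, hs⟩ := exists_surjective_nat H
    obtain ⟨h, hh, hhg⟩ := hne fun n => (s n : ℕ → ℕ) n
    obtain ⟨n, hn⟩ := hs ⟨h, hh⟩
    exact hhg n (by rw [hn])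
  · rw [Cardinal.mk_uLift]
    exact Cardinal.lift_le.2 hH
  · intro Y _ hY hR
    obtain ⟨y⟩ := hY
    let V : ℕ → ℕ → Set (ULift.{u} H × Y) := fun n m => {z | (z.1.down : ℕ → ℕ) n = m}
    -- A selection from the covers by coordinate values is a function `g`, and some member of `H`
    -- differs from it everywhere.
    obtain ⟨U, hU, _, _, hcov, _⟩ := hR (fun n => range (V n)) fun n => by
      refine ⟨countable_range _, ?_, eq_univ_of_forall fun z => ⟨_, mem_range_self _, rfl⟩, ?_⟩
      · rintro _ ⟨m, rfl⟩
        have hc : Continuous fun z : ULift.{u} H × Y => (z.1.down : ℕ → ℕ) n :=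
          (continuous_apply n).comp (continuous_subtype_val.comp
            (continuous_uliftDown.comp continuous_fst))
        exact (isOpen_discrete {m}).preimage hc
      · rintro ⟨m, hm⟩
        obtain ⟨h, hh, hhm⟩ := hne fun _ => m
        have : ((⟨⟨h, hh⟩⟩, y) : ULift.{u} H × Y) ∈ V n m := hm ▸ mem_univ _
        exact hhm n this
    choose g hg using hU
    obtain ⟨h, hh, hhg⟩ := hne g
    have hz : ((⟨⟨h, hh⟩⟩, y) : ULift.{u} H × Y) ∈ ⋃₀ range U := hcov ▸ mem_univ _
    obtain ⟨_, ⟨n, rfl⟩, hn⟩ := hz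
    rw [← hg n] at hn
    exact hhg n hn

theorem exists_infinite_regularSpace_not_gerlitsNagyToRothberger :
    ∃ (X : Type u) (_ : TopologicalSpace X), Infinite X ∧ RegularSpace X ∧
      #X ≤ Cardinal.lift.{u} covMeager ∧ ¬ GerlitsNagyToRothberger.{u, v} X := by
  obtain ⟨X, _, hinf, hreg, hcard, hX⟩ := exists_regularSpace_not_isRothberger_prod.{u, v}
  exact ⟨X, _, hinf, hreg, hcard, fun h =>
    hX (ULift.{v} ℕ) (h (ULift.{v} ℕ) (isGerlitsNagy_of_countable _))⟩

/-! ### Unions of concentrated spaces and the two minima -/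

theorem isConcentrated_of_mk_lt {X : Type u} [TopologicalSpace X] {κ : Cardinal.{u}}
    (h : #X < κ) : IsConcentrated κ X :=
  ⟨∅, countable_empty, fun _ _ _ => (Cardinal.mk_set_le _).trans_lt h⟩

theorem lift_covMeager_mem_badUnionNumbers {μ : Cardinal.{u}} (hμ : ℵ₀ < μ) :
    Cardinal.lift.{u} covMeager ∈ badUnionNumbers.{u, v} μ := by
  obtain ⟨X, _, hinf, hreg, hcard, hX⟩ :=
    exists_infinite_regularSpace_not_gerlitsNagyToRothberger.{u, v}
  obtain ⟨ι, hι⟩ : ∃ ι : Type u, #ι = Cardinal.lift.{u} covMeager := ⟨_, Cardinal.mk_out _⟩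
  rw [← hι] at hcard
  obtain ⟨emb⟩ := hcard
  obtain ⟨s, hs⟩ : ∃ s : ι → X, Function.Surjective s :=
    ⟨Function.invFun emb, Function.invFun_surjective emb.injective⟩
  let D : Set X := range (Infinite.natEmbedding X)
  have hD : D.Infinite := infinite_range_of_injective (Infinite.natEmbedding X).injective
  -- The countable set `D` is added only to make every piece infinite.
  refine ⟨X, _, ι, fun i => insert (s i) D, hinf, hreg, hι, fun i =>
    ⟨hD.mono (subset_insert _ _), isConcentrated_of_mk_lt ?_⟩, ?_, hX⟩
  · exact (Cardinal.le_aleph0_iff_set_countable.2 ((countable_range _).insert _)).trans_lt hμ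
  · refine eq_univ_of_forall fun x => ?_
    obtain ⟨i, rfl⟩ := hs x
    exact mem_iUnion.2 ⟨i, mem_insert _ _⟩

theorem cof_mem_badUnionNumbers :
    (Cardinal.lift.{u} covMeager).ord.cof ∈
      badUnionNumbers.{u, v} (Cardinal.lift.{u} covMeager) := by
  obtain ⟨X, _, hinf, hreg, hcard, hX⟩ :=
    exists_infinite_regularSpace_not_gerlitsNagyToRothberger.{u, v}
  have hunc : ℵ₀ < Cardinal.lift.{u} covMeager := by
    rw [← Cardinal.lift_aleph0.{u, 0}]
    exact Cardinal.lift_lt.2 aleph0_lt_covMeager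
  generalize Cardinal.lift.{u} covMeager = κ at *
  obtain ⟨S, hS, hScard⟩ := Order.exists_cof_eq κ.ord.ToType
  rw [Ordinal.cof_toType] at hScard
  have hX' : #X ≤ #κ.ord.ToType := by rwa [Cardinal.mk_ord_toType]
  obtain ⟨emb⟩ := hX'
  let D : Set X := range (Infinite.natEmbedding X)
  have hD : D.Infinite := infinite_range_of_injective (Infinite.natEmbedding X).injective
  -- The pieces come from initial segments of the initial ordinal of `κ`, taken along a cofinal set.
  refine ⟨X, _, S, fun i => emb ⁻¹' Iic i.1 ∪ D, hinf, hreg, hScard, fun i =>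
    ⟨hD.mono subset_union_right, isConcentrated_of_mk_lt ?_⟩, ?_, hX⟩
  · refine (Cardinal.mk_union_le _ _).trans_lt (Cardinal.add_lt_of_lt hunc.le ?_ ?_)
    · have h1 : #(emb ⁻¹' Iic i.1) ≤ #(Iic i.1) :=
        Cardinal.mk_preimage_of_injective _ _ emb.injective
      refine h1.trans_lt ?_
      rw [← Iio_insert]
      refine Cardinal.mk_insert_le.trans_lt (Cardinal.add_lt_of_lt hunc.le ?_
        (Cardinal.one_lt_aleph0.trans hunc))
      simpa using Cardinal.mk_Iio_lt i.1 (by simp)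
    · exact (Cardinal.le_aleph0_iff_set_countable.2 (countable_range _)).trans_lt hunc
  · refine eq_univ_of_forall fun x => ?_
    obtain ⟨i, hi, hxi⟩ := hS (emb x)
    exact mem_iUnion.2 ⟨⟨i, hi⟩, Or.inl hxi⟩

theorem IsConcentrated.exists_seq {X : Type u} [TopologicalSpace X] {μ : Cardinal.{u}} {C : Set X}
    (hC : C.Nonempty) (h : IsConcentrated μ C) :
    ∃ d : ℕ → X, ∀ W : Set X, IsOpen W → (∀ n, d n ∈ W) → #(C \ W : Set X) < μ := by
  obtain ⟨D, hD, hDU⟩ := h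
  obtain ⟨c, hc⟩ := hC
  obtain ⟨e, he⟩ := (hD.insert ⟨c, hc⟩).exists_eq_range (insert_nonempty _ _)
  refine ⟨fun n => e n, fun W hW hdW => ?_⟩
  have h1 := hDU (Subtype.val ⁻¹' W) (hW.preimage continuous_subtype_val) fun x hx => by
    have : x ∈ range e := he ▸ mem_insert_of_mem _ hx
    obtain ⟨n, rfl⟩ := this
    exact hdW n
  have h2 : (C \ W : Set X) = Subtype.val '' ((Subtype.val ⁻¹' W)ᶜ : Set C) := by
    ext x
    simp
  rw [h2]
  exact Cardinal.mk_image_le.trans_lt h1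

theorem lift_covMeager_le_of_mem_badUnionNumbers {μ κ : Cardinal.{u}}
    (hκ : κ ∈ badUnionNumbers.{u, v} μ)
    (hsum : ∀ (X ι : Type u) (Z : ι → Set X), #ι = κ → (∀ i, #(Z i) < μ) →
      #(⋃ i, Z i) < Cardinal.lift.{u} covMeager) :
    Cardinal.lift.{u} covMeager ≤ κ := by
  by_contra! hlt
  obtain ⟨X, _, ι, C, hinf, _, hι, hC, hcov, hX⟩ := hκ
  refine hX fun Y _ _ _ hY => ?_
  choose d hd using fun i => (hC i).2.exists_seq (hC i).1.nonempty
  exact hY.isRothberger_prod (infinitelyMatchable_of_lt_covMeager (hι ▸ hlt)) C hcov d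
    fun W hW hdW => infinitelyMatchable_of_lt_covMeager
      (hsum X ι _ hι fun i => hd i (W i) (hW i) (hdW i))

theorem theorem3p1 :
    (∀ μ : Cardinal.{u}, μ.IsRegular → ℵ₀ < μ → μ ≤ Cardinal.lift.{u} covMeager →
      IsLeast (badUnionNumbers.{u, v} μ) (Cardinal.lift.{u} covMeager)) ∧
    IsLeast (badUnionNumbers.{u, v} (Cardinal.lift.{u} covMeager))
      (Cardinal.lift.{u} covMeager).ord.cof := by
  refine ⟨fun μ hreg hμ hle => ⟨lift_covMeager_mem_badUnionNumbers hμ, fun κ hκ => ?_⟩,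
    cof_mem_badUnionNumbers, fun κ hκ => ?_⟩
  · by_contra! hlt
    refine hlt.not_ge (lift_covMeager_le_of_mem_badUnionNumbers hκ fun X ι Z hι hZ => ?_)
    -- Regularity of `μ` handles fewer than `μ` pieces; otherwise the union has size at most `κ * κ
    -- = κ`.
    rcases lt_or_ge κ μ with hκμ | hκμ
    · exact ((Cardinal.card_iUnion_lt_iff_forall_of_isRegular hreg (hι ▸ hκμ)).2 hZ).trans_le hle
    · calc #(⋃ i, Z i) ≤ #ι * ⨆ i, #(Z i) := Cardinal.mk_iUnion_le _
        _ ≤ κ * κ := mul_le_mul' hι.le (ciSup_le' fun i => (hZ i).le.trans hκμ)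
        _ = κ := Cardinal.mul_eq_self (hμ.le.trans hκμ)
        _ < _ := hlt
  · by_contra! hlt
    have hlt' := hlt.trans_le (Ordinal.cof_ord_le _)
    refine hlt'.not_ge (lift_covMeager_le_of_mem_badUnionNumbers hκ fun X ι Z hι hZ => ?_)
    have hunc : ℵ₀ ≤ Cardinal.lift.{u} covMeager :=
      Cardinal.aleph0_le_lift.2 aleph0_lt_covMeager.le
    -- Below the cofinality, the supremum of the piece sizes stays below `covMeager`.
    exact (Cardinal.mk_iUnion_le _).trans_lt (Cardinal.mul_lt_of_lt hunc (hι ▸ hlt')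
      (Cardinal.iSup_lt_of_lt_cof_ord (hι ▸ hlt) hZ))
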